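/- All Hilbert spaces are complex and all operators are bounded and linear. For an operator $T$ on a Hilbert space put $\triangle_T = T^*T - I$. The operator $T$ is a *2-isometry* if $T^{*2}T^2 - 2T^*T + I = 0$ (then $\triangle_T \ge 0$). A 2-isometry $T$ is a *Brownian isometry* if $\triangle_T \triangle_{T^*} \triangle_T = 0$, and a *quasi-Brownian isometry* if $\triangle_T T = \triangle_T^{1/2}\, T\, \triangle_T^{1/2}$. An operator $\begin{bmatrix} \tilde A_{11} & \tilde A_{12} \\ \tilde A_{21} & \tilde A_{22} \end{bmatrix}$ on $K_1 \oplus K_2$ is an *entrywise extension* of an operator $\begin{bmatrix} A_{11} & A_{12} \\ A_{21} & A_{22} \end{bmatrix}$ on $H_1 \oplus H_2$ if $H_j \subseteq K_j$ (isometrically) and $\tilde A_{ij} h_j = A_{ij} h_j$ for all $h_j \in H_j$ and $i, j = 1, 2$. Let $T$ be a quasi-Brownian isometry on a Hilbert space $H$. Then there is an orthogonal decomposition $H = H_1 \oplus H_2$ (zero summands allowed) with respect to which $$T = \begin{bmatrix} V & E \\ 0 & S \end{bmatrix}, \qquad V^*V = I, \quad V^*E = 0, \quad S^*S = I, \quad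 S E^*E = E^*E S. \tag{1}$$ Moreover, for every orthogonal decomposition $H = H_1 \oplus H_2$ with respect to which $T$ has the form (1), there exist Hilbert spaces $K_1 \supseteq H_1$, $K_2 \supseteq H_2$ and a Brownian isometry $$R = \begin{bmatrix} \tilde V & \tilde E \\ 0 & U \end{bmatrix} \text{ on } K_1 \oplus K_2, \qquad \tilde V^*\tilde V = I, \quad \tilde V^*\tilde E = 0, \quad U \text{ unitary}, \quad U \tilde E^*\tilde E = \tilde E^*\tilde E U,$$ such that $R$ is an entrywise extension of $T$. -/

import Mathlib

universe u v w

noncomputable section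

namespace Brownian

section SingleOperator

variable {H : Type u} [NormedAddCommGroup H] [InnerProductSpace ℂ H] [CompleteSpace H]

/-- `△_T = T* T - I`. -/
def defect (T : H →L[ℂ] H) : H →L[ℂ] H := star T * T - 1

/-- `T` is a `2`-isometry: `T*² T² - 2 T* T + I = 0`. -/
def IsTwoIsometry (T : H →L[ℂ] H) : Prop :=
  star T ^ 2 * T ^ 2 - 2 • (star T * T) + 1 = 0

/-- A Brownian isometry: a `2`-isometry with `△_T △_{T*} △_T = 0`. -/
def IsBrownianIsometry (T : H →L[ℂ] H) : Prop :=
  IsTwoIsometry T ∧ defect T * defect (star T) * defect T = 0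

/-- A quasi-Brownian isometry: a `2`-isometry with `△_T T = △_T^{1/2} T △_T^{1/2}`.
Here `CFC.sqrt` is the square root of a positive operator; `△_T` is positive for every
`2`-isometry, so this is the usual positive square root. -/
def IsQuasiBrownianIsometry (T : H →L[ℂ] H) : Prop :=
  IsTwoIsometry T ∧ defect T * T = CFC.sqrt (defect T) * T * CFC.sqrt (defect T)

end SingleOperator

/-- The Hilbert space orthogonal sum `H₁ ⊕ H₂`. -/
abbrev HSum (H₁ : Type u) (H₂ : Type v) : Type (max u v) := WithLp 2 (H₁ × H₂)

section Blocks

variable {H₁ : Type u} [NormedAddCommGroup H₁] [InnerProductSpace ℂ H₁]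
  {H₂ : Type v} [NormedAddCommGroup H₂] [InnerProductSpace ℂ H₂]

/-- The embedding of the first summand, `h ↦ (h, 0)`. -/
def inc₁ : H₁ →L[ℂ] HSum H₁ H₂ :=
  ((WithLp.prodContinuousLinearEquiv 2 ℂ H₁ H₂).symm : H₁ × H₂ →L[ℂ] HSum H₁ H₂) ∘L
    ContinuousLinearMap.inl ℂ H₁ H₂

/-- The embedding of the second summand, `h ↦ (0, h)`. -/
def inc₂ : H₂ →L[ℂ] HSum H₁ H₂ :=
  ((WithLp.prodContinuousLinearEquiv 2 ℂ H₁ H₂).symm : H₁ × H₂ →L[ℂ] HSum H₁ H₂) ∘L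
    ContinuousLinearMap.inr ℂ H₁ H₂

/-- The first coordinate. -/
def coord₁ : HSum H₁ H₂ →L[ℂ] H₁ :=
  ContinuousLinearMap.fst ℂ H₁ H₂ ∘L
    (WithLp.prodContinuousLinearEquiv 2 ℂ H₁ H₂ : HSum H₁ H₂ →L[ℂ] H₁ × H₂)

/-- The second coordinate. -/
def coord₂ : HSum H₁ H₂ →L[ℂ] H₂ :=
  ContinuousLinearMap.snd ℂ H₁ H₂ ∘L
    (WithLp.prodContinuousLinearEquiv 2 ℂ H₁ H₂ : HSum H₁ H₂ →L[ℂ] H₁ × H₂)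

/-- The `(1,1)` entry of the block matrix of an operator on `H₁ ⊕ H₂`. -/
def entry₁₁ (A : HSum H₁ H₂ →L[ℂ] HSum H₁ H₂) : H₁ →L[ℂ] H₁ := coord₁ ∘L A ∘L inc₁

/-- The `(1,2)` entry. -/
def entry₁₂ (A : HSum H₁ H₂ →L[ℂ] HSum H₁ H₂) : H₂ →L[ℂ] H₁ := coord₁ ∘L A ∘L inc₂

/-- The `(2,1)` entry. -/
def entry₂₁ (A : HSum H₁ H₂ →L[ℂ] HSum H₁ H₂) : H₁ →L[ℂ] H₂ := coord₂ ∘L A ∘L inc₁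

/-- The `(2,2)` entry. -/
def entry₂₂ (A : HSum H₁ H₂ →L[ℂ] HSum H₁ H₂) : H₂ →L[ℂ] H₂ := coord₂ ∘L A ∘L inc₂

/-- The operator on `H₁ ⊕ H₂` that corresponds to `T` on `H` under an orthogonal decomposition
of `H`, given as a unitary `Φ : H → H₁ ⊕ H₂`. -/
def inDecomposition {H : Type w} [NormedAddCommGroup H] [InnerProductSpace ℂ H]
    (Φ : H ≃ₗᵢ[ℂ] HSum H₁ H₂) (T : H →L[ℂ] H) : HSum H₁ H₂ →L[ℂ] HSum H₁ H₂ :=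
  (Φ.toContinuousLinearEquiv : H →L[ℂ] HSum H₁ H₂) ∘L T ∘L
    (Φ.symm.toContinuousLinearEquiv : HSum H₁ H₂ →L[ℂ] H)

variable [CompleteSpace H₁] [CompleteSpace H₂]

/-- The block matrix of `A` with respect to `H₁ ⊕ H₂` has the Brownian-type form `[V E; 0 X]`:
`V* V = I`, `V* E = 0` and `X E* E = E* E X`. Zero summands are allowed, so that isometries
(which may be irreducible) are covered as well. -/
structure HasBrownianTypeForm (A : HSum H₁ H₂ →L[ℂ] HSum H₁ H₂) : Prop where
  entry₂₁_eq_zero : entry₂₁ A = 0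
  isometry₁₁ : (entry₁₁ A).adjoint ∘L entry₁₁ A = ContinuousLinearMap.id ℂ H₁
  orthogonal : (entry₁₁ A).adjoint ∘L entry₁₂ A = 0
  commute : entry₂₂ A ∘L ((entry₁₂ A).adjoint ∘L entry₁₂ A) =
    ((entry₁₂ A).adjoint ∘L entry₁₂ A) ∘L entry₂₂ A

/-- The Brownian-type form `[V E; 0 X]` with `X` an isometry. -/
def HasIsometricForm (A : HSum H₁ H₂ →L[ℂ] HSum H₁ H₂) : Prop :=
  HasBrownianTypeForm A ∧
    (entry₂₂ A).adjoint ∘L entry₂₂ A = ContinuousLinearMap.id ℂ H₂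

/-- The Brownian-type form `[V E; 0 X]` with `X` unitary. -/
def HasUnitaryForm (A : HSum H₁ H₂ →L[ℂ] HSum H₁ H₂) : Prop :=
  HasBrownianTypeForm A ∧ entry₂₂ A ∈ unitary (H₂ →L[ℂ] H₂)

end Blocks

/-- `B` on `K₁ ⊕ K₂` is an entrywise extension of `A` on `H₁ ⊕ H₂`, where `H₁` and `H₂` are
regarded as subspaces of `K₁` and `K₂` through the isometric embeddings `j₁` and `j₂`: every
entry of `B` extends the corresponding entry of `A`. -/
structure IsEntrywiseExtension
    {H₁ H₂ : Type u} [NormedAddCommGroup H₁] [InnerProductSpace ℂ H₁]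
    [NormedAddCommGroup H₂] [InnerProductSpace ℂ H₂]
    {K₁ K₂ : Type v} [NormedAddCommGroup K₁] [InnerProductSpace ℂ K₁]
    [NormedAddCommGroup K₂] [InnerProductSpace ℂ K₂]
    (j₁ : H₁ →ₗᵢ[ℂ] K₁) (j₂ : H₂ →ₗᵢ[ℂ] K₂)
    (A : HSum H₁ H₂ →L[ℂ] HSum H₁ H₂) (B : HSum K₁ K₂ →L[ℂ] HSum K₁ K₂) : Prop where
  extends₁₁ : ∀ h : H₁, entry₁₁ B (j₁ h) = j₁ (entry₁₁ A h)
  extends₁₂ : ∀ h : H₂, entry₁₂ B (j₂ h) = j₁ (entry₁₂ A h)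
  extends₂₁ : ∀ h : H₁, entry₂₁ B (j₁ h) = j₂ (entry₂₁ A h)
  extends₂₂ : ∀ h : H₂, entry₂₂ B (j₂ h) = j₂ (entry₂₂ A h)

end Brownian

end

/-! Write `△ = T*T - I` and `D = △^{1/2}`. The decomposition is `H = ker △ ⊕ (ker △)ᗮ`. The identity
`△T = DTD` makes `ker △` invariant, and `T` is isometric there. It also sends `T△ - △T` into `ker
△`, so the compression `S` of `T` to `(ker △)ᗮ` satisfies `S△ = △T`. With the 2-isometry identity
`T*△T = △` this makes `S` isometric, and then `E*E` is the restriction of `△` and commutes with `S`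
(`IsQuasiBrownianIsometry.hasIsometricForm`).

For the extension, `S` is replaced by its unitary Halmos dilation on `H₂ ⊕ H₂`, and `V`, `E` by `V ⊕
V`, `E ⊕ E` (`exists_brownianIsometry_extension`). A unitary corner makes the result Brownian
(`isBrownianIsometry_block`). -/

namespace Brownian

open ContinuousLinearMap

noncomputable section

/-! ### Positivity of the defect of a 2-isometry. -/

section TwoIsometry

theorem pow_succ_apply {E : Type*} [NormedAddCommGroup E] [NormedSpace ℂ E] (T : E →L[ℂ] E)
    (n : ℕ) (x : E) : (T ^ (n + 1)) x = T ((T ^ n) x) := by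
  rw [pow_succ']; rfl

variable {H : Type u} [NormedAddCommGroup H] [InnerProductSpace ℂ H] [CompleteSpace H]
  {T : H →L[ℂ] H}

theorem star_defect (T : H →L[ℂ] H) : star (defect T) = defect T := by
  simp [defect]

theorem inner_defect_left (T : H →L[ℂ] H) (x y : H) :
    inner ℂ (defect T x) y = inner ℂ x (defect T y) := by
  conv_lhs => rw [← star_defect T, star_eq_adjoint, adjoint_inner_left]

theorem inner_defect_right (T : H →L[ℂ] H) (x y : H) :
    inner ℂ x (defect T y) = inner ℂ (T x) (T y) - inner ℂ x y := by
  simp [defect, star_eq_adjoint, adjoint_inner_right]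

theorem isTwoIsometry_iff : IsTwoIsometry T ↔ star T * defect T * T = defect T := by
  rw [IsTwoIsometry, ← sub_eq_zero (b := defect T)]
  have : star T ^ 2 * T ^ 2 - 2 • (star T * T) + 1 = star T * defect T * T - defect T := by
    simp only [defect]; noncomm_ring
  rw [this]

theorem IsTwoIsometry.adjoint_defect_apply (hT : IsTwoIsometry T) (x : H) :
    adjoint T (defect T (T x)) = defect T x :=
  DFunLike.congr_fun (isTwoIsometry_iff.1 hT) x

theorem IsTwoIsometry.inner_defect_pow (hT : IsTwoIsometry T) (x : H) (n : ℕ) :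
    inner ℂ ((T ^ n) x) (defect T ((T ^ n) x)) = inner ℂ x (defect T x) := by
  induction n with
  | zero => simp
  | succ n ih =>
    rw [pow_succ_apply, ← adjoint_inner_right, hT.adjoint_defect_apply, ih]

/-- Since `T*△T = △`, each step from `T^n x` to `T^(n+1) x` raises the squared norm by the same
amount `⟨x, △x⟩`. -/
theorem IsTwoIsometry.inner_pow (hT : IsTwoIsometry T) (x : H) (n : ℕ) :
    inner ℂ ((T ^ n) x) ((T ^ n) x) = inner ℂ x x + n * inner ℂ x (defect T x) := by
  induction n with
  | zero => simp
  | succ n ih =>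
    have h := inner_defect_right T ((T ^ n) x) ((T ^ n) x)
    rw [hT.inner_defect_pow, ih] at h
    rw [pow_succ_apply, Nat.cast_succ]
    linear_combination -h

theorem IsTwoIsometry.defect_nonneg (hT : IsTwoIsometry T) : 0 ≤ defect T := by
  rw [nonneg_iff_isPositive, isPositive_def']
  refine ⟨star_defect T, fun x => ?_⟩
  rw [reApplyInnerSelf_apply, inner_defect_left]
  by_contra! hlt
  -- For this `n`, linear growth with negative slope would make `‖T^n x‖²` negative.
  obtain ⟨n, hn⟩ := exists_nat_gt (RCLike.re (inner ℂ x x) / -RCLike.re (inner ℂ x (defect T x)))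
  rw [div_lt_iff₀ (by linarith)] at hn
  have h := congrArg RCLike.re (hT.inner_pow x n)
  have h0 : 0 ≤ RCLike.re (inner ℂ ((T ^ n) x) ((T ^ n) x)) := inner_self_nonneg
  simp only [map_add, RCLike.re_to_complex, Complex.mul_re, Complex.natCast_re,
    Complex.natCast_im, zero_mul, sub_zero] at h h0 hn
  linarith

end TwoIsometry

/-! ### The decomposition along the kernel of the defect. -/

section QuasiBrownian

variable {H : Type u} [NormedAddCommGroup H] [InnerProductSpace ℂ H] [CompleteSpace H]
  {T : H →L[ℂ] H}

theorem sqrt_apply_eq_zero {A : H →L[ℂ] H} (hA : 0 ≤ A) {x : H} (hx : A x = 0) :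
    CFC.sqrt A x = 0 := by
  have hsa : adjoint (CFC.sqrt A) = CFC.sqrt A :=
    (IsSelfAdjoint.of_nonneg (CFC.sqrt_nonneg A)).star_eq
  have hsq : CFC.sqrt A (CFC.sqrt A x) = A x :=
    DFunLike.congr_fun (CFC.sqrt_mul_sqrt_self A hA) x
  rw [← inner_self_eq_zero (𝕜 := ℂ), ← adjoint_inner_right, hsa, hsq, hx, inner_zero_right]

theorem IsQuasiBrownianIsometry.defect_map_eq_zero (hT : IsQuasiBrownianIsometry T) {x : H}
    (hx : defect T x = 0) : defect T (T x) = 0 := by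
  have h : defect T (T x) = CFC.sqrt (defect T) (T (CFC.sqrt (defect T) x)) :=
    DFunLike.congr_fun hT.2 x
  rw [h, sqrt_apply_eq_zero hT.1.defect_nonneg hx, map_zero, map_zero]

/-- From `D²T = DTD` one gets `D(TD - DT) = 0` and `T△ - △T = (TD - DT)D`, so the commutator has
range in `ker D`, which lies in `ker △`. -/
theorem IsQuasiBrownianIsometry.defect_map_defect_sub (hT : IsQuasiBrownianIsometry T) (x : H) :
    defect T (T (defect T x) - defect T (T x)) = 0 := by
  have hsq := CFC.sqrt_mul_sqrt_self (defect T) hT.1.defect_nonneg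
  have h := hT.2
  have hker : ∀ z, CFC.sqrt (defect T) z = 0 → defect T z = 0 := fun z hz => by
    rw [← hsq, ← map_zero (CFC.sqrt (defect T)), ← hz]
    rfl
  set D := CFC.sqrt (defect T)
  have h₁ : D * (T * D - D * T) = 0 := by
    rw [mul_sub, ← mul_assoc, ← mul_assoc, hsq, h, sub_self]
  have h₂ : T * defect T - defect T * T = (T * D - D * T) * D := by
    rw [h, ← hsq]; noncomm_ring
  change defect T ((T * defect T - defect T * T) x) = 0
  rw [h₂]
  exact hker _ (DFunLike.congr_fun h₁ (D x))

theorem IsQuasiBrownianIsometry.hasIsometricForm (hT : IsQuasiBrownianIsometry T) :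
    HasIsometricForm (inDecomposition
      (LinearMap.ker (defect T).toLinearMap).orthogonalDecomposition T) := by
  set K : Submodule ℂ H := LinearMap.ker (defect T).toLinearMap
  have memK : ∀ x, x ∈ K ↔ defect T x = 0 := fun x => LinearMap.mem_ker
  set A := inDecomposition K.orthogonalDecomposition T with hA
  have e₁₁ : ∀ x : K, entry₁₁ A x = K.orthogonalProjectionOnto (T x) := fun x => by
    simp [entry₁₁, hA, inDecomposition, coord₁, inc₁]
  have e₁₂ : ∀ x : Kᗮ, entry₁₂ A x = K.orthogonalProjectionOnto (T x) := fun x => by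
    simp [entry₁₂, hA, inDecomposition, coord₁, inc₂]
  have e₂₁ : ∀ x : K, entry₂₁ A x = Kᗮ.orthogonalProjectionOnto (T x) := fun x => by
    simp [entry₂₁, hA, inDecomposition, coord₂, inc₁]
  have e₂₂ : ∀ x : Kᗮ, entry₂₂ A x = Kᗮ.orthogonalProjectionOnto (T x) := fun x => by
    simp [entry₂₂, hA, inDecomposition, coord₂, inc₂]
  have hTK : ∀ x : K, T x ∈ K := fun x => (memK _).2 (hT.defect_map_eq_zero ((memK _).1 x.2))
  have hV : ∀ x : K, (entry₁₁ A x : H) = T x := fun x => by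
    rw [e₁₁]; exact K.starProjection_eq_self_iff.2 (hTK x)
  have hrange : ∀ x, defect T x ∈ Kᗮ := fun x => by
    rw [Submodule.mem_orthogonal]
    intro y hy
    rw [← inner_defect_left, (memK y).1 hy, inner_zero_left]
  have hsum : ∀ y : Kᗮ, (entry₁₂ A y : H) + entry₂₂ A y = T y := fun y => by
    rw [e₁₂, e₂₂]; exact K.starProjection_add_starProjection_orthogonal (T y)
  have hinner : ∀ y z : Kᗮ, inner ℂ (entry₁₂ A y) (entry₁₂ A z) +
      inner ℂ (entry₂₂ A y) (entry₂₂ A z) = inner ℂ (T y) (T z) := fun y z => by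
    rw [← hsum y, ← hsum z, inner_add_left, inner_add_right, inner_add_right,
      Submodule.inner_right_of_mem_orthogonal (entry₁₂ A y).2 (entry₂₂ A z).2,
      Submodule.inner_left_of_mem_orthogonal (entry₁₂ A z).2 (entry₂₂ A y).2]
    simp
  let Δ : H → Kᗮ := fun x => ⟨defect T x, hrange x⟩
  -- `T△x` and `△Tx` differ by an element of `K`, which the projection onto `Kᗮ` kills.
  have hSΔ : ∀ x, (entry₂₂ A (Δ x) : H) = defect T (T x) := fun x => by
    have hmem : T (defect T x) - defect T (T x) ∈ K := (memK _).2 (hT.defect_map_defect_sub x)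
    rw [e₂₂]
    change Kᗮ.starProjection (T (defect T x)) = _
    rw [← sub_add_cancel (T (defect T x)) (defect T (T x)), map_add,
      Kᗮ.starProjection_eq_self_iff.2 (hrange _),
      Submodule.starProjection_orthogonal_apply_eq_zero hmem, zero_add]
  have hSS : ∀ (y : Kᗮ) x, inner ℂ (entry₂₂ A y) (entry₂₂ A (Δ x)) = inner ℂ y (Δ x) :=
    fun y x => by
    have h := Submodule.inner_right_of_mem_orthogonal (entry₁₂ A y).2 (entry₂₂ A (Δ x)).2
    have h' : inner ℂ (entry₂₂ A y : H) (entry₂₂ A (Δ x) : H) =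
        inner ℂ (T y) (entry₂₂ A (Δ x) : H) := by
      rw [← hsum y, inner_add_left, h, zero_add]
    rw [Submodule.coe_inner, h', hSΔ, ← adjoint_inner_right, hT.1.adjoint_defect_apply]
    rfl
  have hS : (entry₂₂ A).adjoint ∘L entry₂₂ A = ContinuousLinearMap.id ℂ Kᗮ := by
    ext1 y
    rw [← sub_eq_zero]
    -- By `hSS`, `w` is orthogonal to the range of `△`, hence lies in `K` as well as in `Kᗮ`.
    set w : Kᗮ := ((entry₂₂ A).adjoint ∘L entry₂₂ A) y - ContinuousLinearMap.id ℂ Kᗮ y with hw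
    have hwK : (w : H) ∈ K := by
      rw [memK]
      refine ext_inner_right ℂ fun x => ?_
      rw [inner_defect_left, inner_zero_left]
      change inner ℂ w (Δ x) = 0
      rw [hw, inner_sub_left, comp_apply, adjoint_inner_left, hSS, id_apply, sub_self]
    rw [← inner_self_eq_zero (𝕜 := ℂ)]
    rw [Submodule.coe_inner]
    exact Submodule.inner_right_of_mem_orthogonal hwK w.2
  have hEE : ∀ y : Kᗮ, ((entry₁₂ A).adjoint ∘L entry₁₂ A) y = Δ y := fun y => by
    refine ext_inner_left ℂ fun z => ?_
    have h : inner ℂ (entry₂₂ A z) (entry₂₂ A y) = inner ℂ z y := by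
      rw [← adjoint_inner_right, ← comp_apply, hS, id_apply]
    rw [comp_apply, adjoint_inner_right, eq_sub_of_add_eq (hinner z y), h]
    exact (inner_defect_right T z y).symm
  refine ⟨⟨?_, ?_, ?_, ?_⟩, hS⟩
  · ext1 x
    rw [e₂₁]
    exact Subtype.ext (Submodule.starProjection_orthogonal_apply_eq_zero (hTK x))
  · ext1 x
    refine ext_inner_left ℂ fun z => ?_
    rw [comp_apply, adjoint_inner_right, Submodule.coe_inner, hV, hV, id_apply,
      Submodule.coe_inner, ← sub_eq_zero, ← inner_defect_right, (memK _).1 x.2, inner_zero_right]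
  · ext1 y
    refine ext_inner_left ℂ fun z => ?_
    have h : inner ℂ (entry₁₁ A z : H) (T y) = inner ℂ (entry₁₁ A z : H) (entry₁₂ A y : H) := by
      rw [← hsum y, inner_add_right,
        Submodule.inner_right_of_mem_orthogonal (entry₁₁ A z).2 (entry₂₂ A y).2, add_zero]
    have hzy : inner ℂ (z : H) (y : H) = 0 := Submodule.inner_right_of_mem_orthogonal z.2 y.2
    have hTzy : inner ℂ (T z) (T y) = inner ℂ (z : H) (y : H) := by
      rw [← sub_eq_zero, ← inner_defect_right, ← inner_defect_left, (memK _).1 z.2,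
        inner_zero_left]
    rw [comp_apply, adjoint_inner_right, Submodule.coe_inner, ← h, hV, hTzy, hzy, zero_apply,
      inner_zero_right]
  · ext1 y
    change entry₂₂ A (((entry₁₂ A).adjoint ∘L entry₁₂ A) y) =
      ((entry₁₂ A).adjoint ∘L entry₁₂ A) (entry₂₂ A y)
    rw [hEE, hEE]
    refine Subtype.ext ?_
    -- The goal is now `△Ty = △Sy`, and `Ty - Sy = Ey` lies in `ker △`.
    have hmem : T y - entry₂₂ A y ∈ K := by
      rw [← hsum y, add_sub_cancel_right]
      exact (entry₁₂ A y).2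
    rw [hSΔ, ← sub_eq_zero, ← map_sub]
    exact (memK _).1 hmem

end QuasiBrownian

/-! ### Calculus of 2×2 block operators. -/

section BlockOperator

variable {M₁ M₂ N₁ N₂ L₁ L₂ : Type*}
  [NormedAddCommGroup M₁] [InnerProductSpace ℂ M₁] [NormedAddCommGroup M₂] [InnerProductSpace ℂ M₂]
  [NormedAddCommGroup N₁] [InnerProductSpace ℂ N₁] [NormedAddCommGroup N₂] [InnerProductSpace ℂ N₂]
  [NormedAddCommGroup L₁] [InnerProductSpace ℂ L₁] [NormedAddCommGroup L₂] [InnerProductSpace ℂ L₂]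

/-- The operator `M₁ ⊕ M₂ → N₁ ⊕ N₂` with block matrix `[A B; C D]`. -/
def block (A : M₁ →L[ℂ] N₁) (B : M₂ →L[ℂ] N₁) (C : M₁ →L[ℂ] N₂) (D : M₂ →L[ℂ] N₂) :
    HSum M₁ M₂ →L[ℂ] HSum N₁ N₂ :=
  inc₁ ∘L (A ∘L coord₁ + B ∘L coord₂) + inc₂ ∘L (C ∘L coord₁ + D ∘L coord₂)

theorem block_apply (A : M₁ →L[ℂ] N₁) (B : M₂ →L[ℂ] N₁) (C : M₁ →L[ℂ] N₂) (D : M₂ →L[ℂ] N₂)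
    (x : HSum M₁ M₂) :
    block A B C D x = WithLp.toLp 2 (A x.fst + B x.snd, C x.fst + D x.snd) := by
  apply (WithLp.prodContinuousLinearEquiv 2 ℂ N₁ N₂).injective
  simp [block, inc₁, inc₂, coord₁, coord₂]

theorem block_comp_block (A : N₁ →L[ℂ] L₁) (B : N₂ →L[ℂ] L₁) (C : N₁ →L[ℂ] L₂) (D : N₂ →L[ℂ] L₂)
    (A' : M₁ →L[ℂ] N₁) (B' : M₂ →L[ℂ] N₁) (C' : M₁ →L[ℂ] N₂) (D' : M₂ →L[ℂ] N₂) :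
    block A B C D ∘L block A' B' C' D' =
      block (A ∘L A' + B ∘L C') (A ∘L B' + B ∘L D') (C ∘L A' + D ∘L C') (C ∘L B' + D ∘L D') := by
  ext1 x
  apply (WithLp.prodContinuousLinearEquiv 2 ℂ L₁ L₂).injective
  ext <;> simp [block_apply] <;> abel

theorem block_id : block (ContinuousLinearMap.id ℂ M₁) 0 0 (ContinuousLinearMap.id ℂ M₂) =
    ContinuousLinearMap.id ℂ (HSum M₁ M₂) := by
  ext1 x
  apply (WithLp.prodContinuousLinearEquiv 2 ℂ M₁ M₂).injective
  ext <;> simp [block_apply]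

theorem block_zero : block 0 0 0 0 = (0 : HSum M₁ M₂ →L[ℂ] HSum N₁ N₂) := by
  ext1 x
  simp [block_apply]

theorem block_sub (A A' : M₁ →L[ℂ] N₁) (B B' : M₂ →L[ℂ] N₁) (C C' : M₁ →L[ℂ] N₂)
    (D D' : M₂ →L[ℂ] N₂) :
    block A B C D - block A' B' C' D' = block (A - A') (B - B') (C - C') (D - D') := by
  ext1 x
  apply (WithLp.prodContinuousLinearEquiv 2 ℂ N₁ N₂).injective
  ext <;> simp [block_apply] <;> abel

theorem adjoint_block [CompleteSpace M₁] [CompleteSpace M₂] [CompleteSpace N₁] [CompleteSpace N₂]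
    (A : M₁ →L[ℂ] N₁) (B : M₂ →L[ℂ] N₁) (C : M₁ →L[ℂ] N₂) (D : M₂ →L[ℂ] N₂) :
    (block A B C D).adjoint = block A.adjoint C.adjoint B.adjoint D.adjoint := by
  symm
  rw [eq_adjoint_iff]
  intro x y
  simp only [block_apply, WithLp.prod_inner_apply, inner_add_left, inner_add_right,
    adjoint_inner_left, WithLp.ofLp_fst, WithLp.ofLp_snd]
  abel

theorem entry₁₁_block (A : M₁ →L[ℂ] M₁) (B : M₂ →L[ℂ] M₁) (C : M₁ →L[ℂ] M₂) (D : M₂ →L[ℂ] M₂) :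
    entry₁₁ (block A B C D) = A := by
  ext1 x; simp [entry₁₁, block_apply, inc₁, coord₁]

theorem entry₁₂_block (A : M₁ →L[ℂ] M₁) (B : M₂ →L[ℂ] M₁) (C : M₁ →L[ℂ] M₂) (D : M₂ →L[ℂ] M₂) :
    entry₁₂ (block A B C D) = B := by
  ext1 x; simp [entry₁₂, block_apply, inc₂, coord₁]

theorem entry₂₁_block (A : M₁ →L[ℂ] M₁) (B : M₂ →L[ℂ] M₁) (C : M₁ →L[ℂ] M₂) (D : M₂ →L[ℂ] M₂) :
    entry₂₁ (block A B C D) = C := by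
  ext1 x; simp [entry₂₁, block_apply, inc₁, coord₂]

theorem entry₂₂_block (A : M₁ →L[ℂ] M₁) (B : M₂ →L[ℂ] M₁) (C : M₁ →L[ℂ] M₂) (D : M₂ →L[ℂ] M₂) :
    entry₂₂ (block A B C D) = D := by
  ext1 x; simp [entry₂₂, block_apply, inc₂, coord₂]

/-- The embedding of the first summand as a linear isometry. -/
def incIsometry (M₁ M₂ : Type*) [NormedAddCommGroup M₁] [InnerProductSpace ℂ M₁]
    [NormedAddCommGroup M₂] [InnerProductSpace ℂ M₂] : M₁ →ₗᵢ[ℂ] HSum M₁ M₂ where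
  toLinearMap := (inc₁ : M₁ →L[ℂ] HSum M₁ M₂).toLinearMap
  norm_map' x := by simp [inc₁]

theorem incIsometry_apply (x : M₁) : incIsometry M₁ M₂ x = WithLp.toLp 2 (x, 0) := rfl

end BlockOperator

/-! ### Block operators with a unitary corner are Brownian. -/

section UnitaryForm

variable {K₁ K₂ : Type*} [NormedAddCommGroup K₁] [InnerProductSpace ℂ K₁] [CompleteSpace K₁]
  [NormedAddCommGroup K₂] [InnerProductSpace ℂ K₂] [CompleteSpace K₂]

/-- Here `△_R = 0 ⊕ E*E`, so `△_R △_{R*} △_R` sees only the (2,2) entry of `△_{R*}`, which is `UU* -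
I = 0`. -/
theorem isBrownianIsometry_block {V : K₁ →L[ℂ] K₁} {E : K₂ →L[ℂ] K₁} {U : K₂ →L[ℂ] K₂}
    (hV : V.adjoint ∘L V = ContinuousLinearMap.id ℂ K₁) (hVE : V.adjoint ∘L E = 0)
    (hU : U ∈ unitary (K₂ →L[ℂ] K₂))
    (hUE : U ∘L (E.adjoint ∘L E) = (E.adjoint ∘L E) ∘L U) :
    IsBrownianIsometry (block V E 0 U) := by
  have hU₁ : U.adjoint ∘L U = ContinuousLinearMap.id ℂ K₂ := hU.1
  have hU₂ : U ∘L U.adjoint = ContinuousLinearMap.id ℂ K₂ := hU.2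
  have hEV : E.adjoint ∘L V = 0 := by
    have := congrArg ContinuousLinearMap.adjoint hVE
    rwa [adjoint_comp, adjoint_adjoint, map_zero] at this
  have hΔ : defect (block V E 0 U) = block 0 0 0 (E.adjoint ∘L E) := by
    change (block V E 0 U).adjoint ∘L block V E 0 U - ContinuousLinearMap.id ℂ (HSum K₁ K₂) = _
    rw [adjoint_block, block_comp_block, ← block_id, block_sub]
    simp [hV, hVE, hEV, hU₁]
  have hΔ' : defect (star (block V E 0 U)) = block (V ∘L V.adjoint + E ∘L E.adjoint -
      ContinuousLinearMap.id ℂ K₁) (E ∘L U.adjoint) (U ∘L E.adjoint) 0 := by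
    rw [defect, star_star]
    change block V E 0 U ∘L (block V E 0 U).adjoint - ContinuousLinearMap.id ℂ (HSum K₁ K₂) = _
    rw [adjoint_block, block_comp_block, ← block_id, block_sub]
    simp [hU₂]
  constructor
  · rw [isTwoIsometry_iff, hΔ]
    change ((block V E 0 U).adjoint ∘L block 0 0 0 (E.adjoint ∘L E)) ∘L block V E 0 U = _
    rw [adjoint_block, block_comp_block, block_comp_block]
    simp only [comp_zero, zero_comp, add_zero, zero_add, comp_assoc, map_zero]
    rw [← comp_assoc E.adjoint, ← hUE, ← comp_assoc, hU₁, id_comp]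
  · rw [hΔ, hΔ']
    change (block 0 0 0 (E.adjoint ∘L E) ∘L _) ∘L block 0 0 0 (E.adjoint ∘L E) = _
    rw [block_comp_block, block_comp_block, ← block_zero]
    simp

end UnitaryForm

/-! ### Dilation of the isometric corner to a unitary. -/

section Extension

variable {H₁ H₂ : Type u} [NormedAddCommGroup H₁] [InnerProductSpace ℂ H₁] [CompleteSpace H₁]
  [NormedAddCommGroup H₂] [InnerProductSpace ℂ H₂] [CompleteSpace H₂]

/-- The Halmos dilation `[S I-SS*; 0 S*]`. For an isometry `S` it is a unitary extension of `S`. -/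
def halmos (S : H₂ →L[ℂ] H₂) : HSum H₂ H₂ →L[ℂ] HSum H₂ H₂ :=
  block S (ContinuousLinearMap.id ℂ H₂ - S ∘L S.adjoint) 0 S.adjoint

theorem halmos_mem_unitary {S : H₂ →L[ℂ] H₂}
    (hS : S.adjoint ∘L S = ContinuousLinearMap.id ℂ H₂) :
    halmos S ∈ unitary (HSum H₂ H₂ →L[ℂ] HSum H₂ H₂) := by
  have hS' : ∀ x, S.adjoint (S x) = x := DFunLike.congr_fun hS
  have hP : (ContinuousLinearMap.id ℂ H₂ - S ∘L S.adjoint).adjoint =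
      ContinuousLinearMap.id ℂ H₂ - S ∘L S.adjoint := by
    rw [map_sub, adjoint_comp, adjoint_adjoint, adjoint_id]
  constructor
  · change (halmos S).adjoint ∘L halmos S = ContinuousLinearMap.id ℂ _
    rw [halmos, adjoint_block, hP, block_comp_block, ← block_id]
    congr 1 <;> ext x <;> simp [hS']
  · change halmos S ∘L (halmos S).adjoint = ContinuousLinearMap.id ℂ _
    rw [halmos, adjoint_block, hP, block_comp_block, ← block_id]
    congr 1 <;> ext x <;> simp [hS']

/-- As `Q` is self-adjoint, commuting with `S` forces commuting with `S*`, hence with every entry of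
the dilation. -/
theorem halmos_comp_diagonal {S Q : H₂ →L[ℂ] H₂} (hQ : Q.adjoint = Q) (h : S ∘L Q = Q ∘L S) :
    halmos S ∘L block Q 0 0 Q = block Q 0 0 Q ∘L halmos S := by
  have h' : S.adjoint ∘L Q = Q ∘L S.adjoint := by
    have := congrArg ContinuousLinearMap.adjoint h
    rw [adjoint_comp, adjoint_comp, hQ] at this
    exact this.symm
  have hP : (ContinuousLinearMap.id ℂ H₂ - S ∘L S.adjoint) ∘L Q =
      Q ∘L (ContinuousLinearMap.id ℂ H₂ - S ∘L S.adjoint) := by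
    rw [sub_comp, comp_sub, id_comp, comp_id, comp_assoc, h', ← comp_assoc, h, comp_assoc]
  rw [halmos, block_comp_block, block_comp_block]
  simp [h, h', hP]

/-- Doubling `E` to `E ⊕ E`, rather than padding by zero, turns `E*E` into `E*E ⊕ E*E`, which
commutes with the off-diagonal entry `I - SS*` of the dilation too. `V` is doubled to stay an
isometry with range orthogonal to that of `E ⊕ E`. -/
theorem exists_brownianIsometry_extension {A : HSum H₁ H₂ →L[ℂ] HSum H₁ H₂}
    (hA : HasIsometricForm A) :
    ∃ R : HSum (HSum H₁ H₁) (HSum H₂ H₂) →L[ℂ] HSum (HSum H₁ H₁) (HSum H₂ H₂),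
      IsBrownianIsometry R ∧ HasUnitaryForm R ∧
        IsEntrywiseExtension (incIsometry H₁ H₁) (incIsometry H₂ H₂) A R := by
  obtain ⟨⟨h₂₁, hV, hVE, hSE⟩, hS⟩ := hA
  set V := entry₁₁ A with hVdef
  set E := entry₁₂ A with hEdef
  set S := entry₂₂ A with hSdef
  have hV' : (block V 0 0 V).adjoint ∘L block V 0 0 V = ContinuousLinearMap.id ℂ (HSum H₁ H₁) := by
    rw [adjoint_block, block_comp_block, ← block_id]
    simp [hV]
  have hVE' : (block V 0 0 V).adjoint ∘L block E 0 0 E = 0 := by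
    rw [adjoint_block, block_comp_block, ← block_zero]
    simp [hVE]
  have hEE : (block E 0 0 E).adjoint ∘L block E 0 0 E =
      block (E.adjoint ∘L E) 0 0 (E.adjoint ∘L E) := by
    rw [adjoint_block, block_comp_block]
    simp
  have hUE : halmos S ∘L ((block E 0 0 E).adjoint ∘L block E 0 0 E) =
      ((block E 0 0 E).adjoint ∘L block E 0 0 E) ∘L halmos S := by
    rw [hEE]
    exact halmos_comp_diagonal (by rw [adjoint_comp, adjoint_adjoint]) hSE
  have hU := halmos_mem_unitary hS
  refine ⟨block (block V 0 0 V) (block E 0 0 E) 0 (halmos S),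
    isBrownianIsometry_block hV' hVE' hU hUE, ⟨⟨?_, ?_, ?_, ?_⟩, ?_⟩, ⟨?_, ?_, ?_, ?_⟩⟩
  · exact entry₂₁_block ..
  · rwa [entry₁₁_block]
  · rwa [entry₁₁_block, entry₁₂_block]
  · rwa [entry₂₂_block, entry₁₂_block]
  · rwa [entry₂₂_block]
  · intro h
    simp [entry₁₁_block, block_apply, incIsometry_apply, hVdef]
  · intro h
    simp [entry₁₂_block, block_apply, incIsometry_apply, hEdef]
  · intro h
    rw [entry₂₁_block, h₂₁, zero_apply, zero_apply, map_zero]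
  · intro h
    simp [entry₂₂_block, halmos, block_apply, incIsometry_apply, hSdef]

end Extension

end

end Brownian

theorem corollary1p6 {H : Type u} [NormedAddCommGroup H] [InnerProductSpace ℂ H]
    [CompleteSpace H] (T : H →L[ℂ] H) (hT : Brownian.IsQuasiBrownianIsometry T) :
    (∃ (H₁ H₂ : Type u)
        (_ : NormedAddCommGroup H₁) (_ : InnerProductSpace ℂ H₁) (_ : CompleteSpace H₁)
        (_ : NormedAddCommGroup H₂) (_ : InnerProductSpace ℂ H₂) (_ : CompleteSpace H₂)
        (Φ : H ≃ₗᵢ[ℂ] Brownian.HSum H₁ H₂),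
        Brownian.HasIsometricForm (Brownian.inDecomposition Φ T)) ∧
    (∀ (H₁ H₂ : Type u)
        [NormedAddCommGroup H₁] [InnerProductSpace ℂ H₁] [CompleteSpace H₁]
        [NormedAddCommGroup H₂] [InnerProductSpace ℂ H₂] [CompleteSpace H₂]
        (Φ : H ≃ₗᵢ[ℂ] Brownian.HSum H₁ H₂),
        Brownian.HasIsometricForm (Brownian.inDecomposition Φ T) →
        ∃ (K₁ K₂ : Type u)
          (_ : NormedAddCommGroup K₁) (_ : InnerProductSpace ℂ K₁) (_ : CompleteSpace K₁)
          (_ : NormedAddCommGroup K₂) (_ : InnerProductSpace ℂ K₂) (_ : CompleteSpace K₂)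
          (j₁ : H₁ →ₗᵢ[ℂ] K₁) (j₂ : H₂ →ₗᵢ[ℂ] K₂)
          (R : Brownian.HSum K₁ K₂ →L[ℂ] Brownian.HSum K₁ K₂),
          Brownian.IsBrownianIsometry R ∧ Brownian.HasUnitaryForm R ∧
          Brownian.IsEntrywiseExtension j₁ j₂ (Brownian.inDecomposition Φ T) R) := by
  refine ⟨?_, fun H₁ H₂ _ _ _ _ _ _ Φ hΦ => ?_⟩
  · let K : Submodule ℂ H := LinearMap.ker (Brownian.defect T).toLinearMap
    have : CompleteSpace K := (Brownian.defect T).isClosed_ker.completeSpace_coe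
    exact ⟨K, Kᗮ, inferInstance, inferInstance, this, inferInstance, inferInstance,
      inferInstance, K.orthogonalDecomposition, hT.hasIsometricForm⟩
  · obtain ⟨R, hR⟩ := Brownian.exists_brownianIsometry_extension hΦ
    exact ⟨Brownian.HSum H₁ H₁, Brownian.HSum H₂ H₂, inferInstance, inferInstance, inferInstance,
      inferInstance, inferInstance, inferInstance, Brownian.incIsometry H₁ H₁,
      Brownian.incIsometry H₂ H₂, R, hR⟩
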